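/- Let $\mathit{Atm}_0$ be a countably infinite set of atomic propositions and $\mathit{Val}$ a finite set of output values. The formulas of the language $\mathcal{L}^{dyn}$ are given by $$\varphi ::= p \mid \mathsf{t}(x) \mid \neg\varphi \mid \varphi\wedge\psi \mid \Box_I\varphi \mid \Box_F\varphi \mid [\varphi]\psi \qquad (p\in \mathit{Atm}_0,\ x\in \mathit{Val}),$$ with $\vee,\to,\leftrightarrow$ the usual classical abbreviations. *Semantics.* A multi-classifier model (MCM) is a pair $\Gamma=(S,\Phi)$ with $S\subseteq 2^{\mathit{Atm}_0}$ and $\Phi\subseteq \mathit{Val}^S$. For $s\in S$ and $f\in\Phi$: $(\Gamma,s,f)\models p$ iff $p\in s$; $(\Gamma,s,f)\models \mathsf{t}(x)$ iff $f(s)=x$; $\neg,\wedge$ are classical; $(\Gamma,s,f)\models\Box_I\varphi$ iff $(\Gamma,s',f)\models\varphi$ for all $s'\in S$; $(\Gamma,s,f)\models\Box_F\varphi$ iff $(\Gamma,s,f')\models\varphi$ for all $f'\in\Phi$; and $(\Gamma,s,f)\models[\varphi]\psi$ iff $(\Gamma,s,f)\models\Box_I\varphi$ implies $(\Gamma^\varphi,s,f)\models\psi$,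 where $\Gamma^\varphi=(S,\{f'\in\Phi : (\Gamma,s',f')\models\varphi \text{ for all } s'\in S\})$. A formula is valid for MCMs if $(\Gamma,s,f)\models\varphi$ for every MCM $\Gamma=(S,\Phi)$, $s\in S$ and $f\in\Phi$. *Logic.* D-WPLC is the Hilbert system in the language $\mathcal{L}^{dyn}$ that consists of all classical propositional tautologies and modus ponens; for each $\blacksquare\in\{\Box_I,\Box_F\}$ the axioms $(\blacksquare\varphi\wedge\blacksquare(\varphi\to\psi))\to\blacksquare\psi$, $\blacksquare\varphi\to\varphi$, $\blacksquare\varphi\to\blacksquare\blacksquare\varphi$, $\neg\blacksquare\varphi\to\blacksquare\neg\blacksquare\varphi$ and the rule: from $\varphi$ infer $\blacksquare\varphi$; the axioms $\Box_F\Box_I\varphi\leftrightarrow\Box_I\Box_F\varphi$, $\bigvee_{x\in \mathit{Val}}\mathsf{t}(x)$, $\mathsf{t}(x)\to\neg\mathsf{t}(y)$ for $x\ne y$, $p\to\Box_F p$, $\neg p\to\Box_F\neg p$; the reduction axioms $$[\varphi]p\leftrightarrow(\Box_I\varphi\to p),\qquad [\varphi]\mathsf{t}(x)\leftrightarrow(\Box_I\varphi\to\mathsf{t}(x)),\qquad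 [\varphi]\neg\psi\leftrightarrow(\Box_I\varphi\to\neg[\varphi]\psi),$$ $$[\varphi](\psi_1\wedge\psi_2)\leftrightarrow([\varphi]\psi_1\wedge[\varphi]\psi_2),$$ $$[\varphi]\Box_I\psi\leftrightarrow(\Box_I\varphi\to\Box_I[\varphi]\psi),\qquad [\varphi]\Box_F\psi\leftrightarrow(\Box_I\varphi\to\Box_F[\varphi]\psi);$$ and the rule of replacement of equivalents: from $\varphi_1\leftrightarrow\varphi_2$ infer $\psi\leftrightarrow\psi'$ whenever $\psi'$ results from $\psi$ by replacing zero or more occurrences of $\varphi_1$ by $\varphi_2$. **Theorem.** D-WPLC is sound and complete for the class of MCMs: a formula $\varphi$ of $\mathcal{L}^{dyn}$ is a theorem of D-WPLC if and only if it is valid for MCMs. -/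

import Mathlib

namespace DWPLC

/-- The dynamic language: input atoms `p`, decision atoms `t(x)`, negation, conjunction,
the two boxes `□_I`, `□_F`, and the update operator `[φ] ψ`. -/
inductive Form (Atm : Type*) (Val : Type*) where
  | atom (p : Atm) : Form Atm Val
  | dec (x : Val) : Form Atm Val
  | neg (φ : Form Atm Val) : Form Atm Val
  | and (φ ψ : Form Atm Val) : Form Atm Val
  | boxI (φ : Form Atm Val) : Form Atm Val
  | boxF (φ : Form Atm Val) : Form Atm Val
  | upd (φ ψ : Form Atm Val) : Form Atm Val

namespace Form

variable {Atm Val : Type*}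

/-- `φ → ψ` -/
def imp (φ ψ : Form Atm Val) : Form Atm Val := neg (and φ (neg ψ))

/-- `φ ↔ ψ` -/
def iff (φ ψ : Form Atm Val) : Form Atm Val := and (imp φ ψ) (imp ψ φ)

/-- `φ ∨ ψ` -/
def or (φ ψ : Form Atm Val) : Form Atm Val := neg (and (neg φ) (neg ψ))

/-- The contradiction `p ∧ ¬ p` for a fixed atom `p`; the value of an empty disjunction. -/
noncomputable def bot [Nonempty Atm] : Form Atm Val :=
  and (atom (Classical.arbitrary Atm)) (neg (atom (Classical.arbitrary Atm)))

/-- The disjunction of all decision atoms. -/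
noncomputable def someDec [Nonempty Atm] [Fintype Val] : Form Atm Val :=
  (((Finset.univ : Finset Val).toList.map dec).foldr or bot)

/-- Truth of a formula under a propositional assignment `v`, where every formula whose main
operator is not `¬` or `∧` counts as a propositional letter. -/
def propEval (v : Form Atm Val → Prop) : Form Atm Val → Prop
  | neg φ => ¬ propEval v φ
  | and φ ψ => propEval v φ ∧ propEval v ψ
  | atom p => v (atom p)
  | dec x => v (dec x)
  | boxI φ => v (boxI φ)
  | boxF φ => v (boxF φ)
  | upd φ ψ => v (upd φ ψ)

/-- Instances of classical propositional tautologies in the dynamic language. -/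
def Tautology (φ : Form Atm Val) : Prop := ∀ v : Form Atm Val → Prop, propEval v φ

/-- `Repl φ₁ φ₂ ψ ψ'`: the formula `ψ'` results from `ψ` by replacing zero or more
occurrences of the subformula `φ₁` by `φ₂`. -/
inductive Repl (φ₁ φ₂ : Form Atm Val) : Form Atm Val → Form Atm Val → Prop where
  | here : Repl φ₁ φ₂ φ₁ φ₂
  | refl (ψ : Form Atm Val) : Repl φ₁ φ₂ ψ ψ
  | neg {ψ ψ' : Form Atm Val} : Repl φ₁ φ₂ ψ ψ' → Repl φ₁ φ₂ (neg ψ) (neg ψ')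
  | and {ψ ψ' χ χ' : Form Atm Val} : Repl φ₁ φ₂ ψ ψ' → Repl φ₁ φ₂ χ χ' →
      Repl φ₁ φ₂ (and ψ χ) (and ψ' χ')
  | boxI {ψ ψ' : Form Atm Val} : Repl φ₁ φ₂ ψ ψ' → Repl φ₁ φ₂ (boxI ψ) (boxI ψ')
  | boxF {ψ ψ' : Form Atm Val} : Repl φ₁ φ₂ ψ ψ' → Repl φ₁ φ₂ (boxF ψ) (boxF ψ')
  | upd {ψ ψ' χ χ' : Form Atm Val} : Repl φ₁ φ₂ ψ ψ' → Repl φ₁ φ₂ χ χ' →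
      Repl φ₁ φ₂ (upd ψ χ) (upd ψ' χ')

end Form

open Form in
/-- Theorems of the logic D-WPLC. -/
inductive Provable {Atm Val : Type*} [Nonempty Atm] [Fintype Val] : Form Atm Val → Prop where
  -- classical propositional logic
  | taut {φ : Form Atm Val} : Tautology φ → Provable φ
  | mp {φ ψ : Form Atm Val} : Provable (imp φ ψ) → Provable φ → Provable ψ
  -- S5 for the box over inputs
  | kI (φ ψ : Form Atm Val) : Provable (imp (and (boxI φ) (boxI (imp φ ψ))) (boxI ψ))
  | tI (φ : Form Atm Val) : Provable (imp (boxI φ) φ)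
  | fourI (φ : Form Atm Val) : Provable (imp (boxI φ) (boxI (boxI φ)))
  | fiveI (φ : Form Atm Val) : Provable (imp (neg (boxI φ)) (boxI (neg (boxI φ))))
  | necI {φ : Form Atm Val} : Provable φ → Provable (boxI φ)
  -- S5 for the box over functions
  | kF (φ ψ : Form Atm Val) : Provable (imp (and (boxF φ) (boxF (imp φ ψ))) (boxF ψ))
  | tF (φ : Form Atm Val) : Provable (imp (boxF φ) φ)
  | fourF (φ : Form Atm Val) : Provable (imp (boxF φ) (boxF (boxF φ)))
  | fiveF (φ : Form Atm Val) : Provable (imp (neg (boxF φ)) (boxF (neg (boxF φ))))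
  | necF {φ : Form Atm Val} : Provable φ → Provable (boxF φ)
  -- interaction, decision atoms, independence
  | comm (φ : Form Atm Val) : Provable (iff (boxF (boxI φ)) (boxI (boxF φ)))
  | atLeast : Provable someDec
  | atMost {x y : Val} : x ≠ y → Provable (imp (dec x) (neg (dec y)))
  | indepPos (p : Atm) : Provable (imp (atom p) (boxF (atom p)))
  | indepNeg (p : Atm) : Provable (imp (neg (atom p)) (boxF (neg (atom p))))
  -- reduction axioms for the update operators
  | redAtom (φ : Form Atm Val) (p : Atm) :
      Provable (iff (upd φ (atom p)) (imp (boxI φ) (atom p)))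
  | redDec (φ : Form Atm Val) (x : Val) :
      Provable (iff (upd φ (dec x)) (imp (boxI φ) (dec x)))
  | redNeg (φ ψ : Form Atm Val) :
      Provable (iff (upd φ (neg ψ)) (imp (boxI φ) (neg (upd φ ψ))))
  | redAnd (φ ψ₁ ψ₂ : Form Atm Val) :
      Provable (iff (upd φ (and ψ₁ ψ₂)) (and (upd φ ψ₁) (upd φ ψ₂)))
  | redBoxI (φ ψ : Form Atm Val) :
      Provable (iff (upd φ (boxI ψ)) (imp (boxI φ) (boxI (upd φ ψ))))
  | redBoxF (φ ψ : Form Atm Val) :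
      Provable (iff (upd φ (boxF ψ)) (imp (boxI φ) (boxF (upd φ ψ))))
  -- replacement of provable equivalents
  | re {φ₁ φ₂ ψ ψ' : Form Atm Val} :
      Provable (iff φ₁ φ₂) → Repl φ₁ φ₂ ψ ψ' → Provable (iff ψ ψ')

/-- A multi-classifier model `(S, Φ)`: a set `S` of input instances (sets of input atoms)
and a set `Φ` of functions from `S` to the output values. -/
structure MCM (Atm : Type*) (Val : Type*) where
  /-- the input instances -/
  S : Set (Set Atm)
  /-- the classifiers -/
  Φ : Set (S → Val)

variable {Atm Val : Type*}

/-- Satisfaction `(Γ, s, f) ⊨ φ`; used for pointed models, that is, for `f ∈ Γ.Φ`.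
The update by `φ` keeps `S` and keeps those `f' ∈ Γ.Φ` that satisfy `φ` at all inputs. -/
def Sat : Form Atm Val → (Γ : MCM Atm Val) → Γ.S → (Γ.S → Val) → Prop
  | .atom p, _, s, _ => p ∈ s.1
  | .dec x, _, s, f => f s = x
  | .neg φ, Γ, s, f => ¬ Sat φ Γ s f
  | .and φ ψ, Γ, s, f => Sat φ Γ s f ∧ Sat ψ Γ s f
  | .boxI φ, Γ, _, f => ∀ s' : Γ.S, Sat φ Γ s' f
  | .boxF φ, Γ, s, _ => ∀ f' ∈ Γ.Φ, Sat φ Γ s f'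
  | .upd φ ψ, Γ, s, f =>
      (∀ s' : Γ.S, Sat φ Γ s' f) →
        Sat ψ ⟨Γ.S, {f' | f' ∈ Γ.Φ ∧ ∀ s' : Γ.S, Sat φ Γ s' f'}⟩ s f

/-- Satisfiability relative to the class of all multi-classifier models. -/
def Satisfiable (φ : Form Atm Val) : Prop :=
  ∃ (Γ : MCM Atm Val) (s : Γ.S) (f : Γ.S → Val), f ∈ Γ.Φ ∧ Sat φ Γ s f

/-- Validity relative to the class of all multi-classifier models. -/
def Valid (φ : Form Atm Val) : Prop := ¬ Satisfiable (Form.neg φ)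

end DWPLC

namespace DWPLC

open Form

section Soundness

variable {Atm Val : Type*}

theorem sat_imp {φ ψ : Form Atm Val} {Γ : MCM Atm Val} {s : Γ.S} {f : Γ.S → Val} :
    Sat (imp φ ψ) Γ s f ↔ (Sat φ Γ s f → Sat ψ Γ s f) := by
  simp only [imp, Sat]; tauto

theorem sat_iff {φ ψ : Form Atm Val} {Γ : MCM Atm Val} {s : Γ.S} {f : Γ.S → Val} :
    Sat (iff φ ψ) Γ s f ↔ (Sat φ Γ s f ↔ Sat ψ Γ s f) := by
  simp only [Form.iff, Sat, sat_imp]; tauto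

theorem propEval_sat (φ : Form Atm Val) (Γ : MCM Atm Val) (s : Γ.S) (f : Γ.S → Val) :
    propEval (fun ψ => Sat ψ Γ s f) φ ↔ Sat φ Γ s f := by
  induction φ with
  | neg φ ih => simp only [propEval, Sat, ih]
  | and φ ψ ih₁ ih₂ => simp only [propEval, Sat, ih₁, ih₂]
  | _ => rfl

theorem sat_foldr_or [Nonempty Atm] {l : List Val} {x : Val} (hx : x ∈ l) {Γ : MCM Atm Val}
    {s : Γ.S} {f : Γ.S → Val} (h : Sat (dec x) Γ s f) :
    Sat ((l.map dec).foldr Form.or bot) Γ s f := by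
  induction l with
  | nil => simp at hx
  | cons a l ih =>
    simp only [List.map_cons, List.foldr_cons, Form.or, Sat]
    rcases List.mem_cons.1 hx with rfl | hx
    · exact fun h' => h'.1 h
    · exact fun h' => h'.2 (ih hx)

/-- Replacing equivalents preserves truth in all pointed models. -/
theorem sat_repl {φ₁ φ₂ ψ ψ' : Form Atm Val}
    (h : ∀ (Γ : MCM Atm Val) (s : Γ.S) (f : Γ.S → Val), f ∈ Γ.Φ →
      (Sat φ₁ Γ s f ↔ Sat φ₂ Γ s f)) (hr : Repl φ₁ φ₂ ψ ψ') :
    ∀ (Γ : MCM Atm Val) (s : Γ.S) (f : Γ.S → Val), f ∈ Γ.Φ →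
      (Sat ψ Γ s f ↔ Sat ψ' Γ s f) := by
  induction hr with
  | here => exact h
  | refl ψ => exact fun _ _ _ _ => Iff.rfl
  | neg _ ih => exact fun Γ s f hf => not_congr (ih Γ s f hf)
  | and _ _ ih₁ ih₂ => exact fun Γ s f hf => and_congr (ih₁ Γ s f hf) (ih₂ Γ s f hf)
  | boxI _ ih => exact fun Γ s f hf => forall_congr' fun s' => ih Γ s' f hf
  | boxF _ ih => exact fun Γ s f hf => forall₂_congr fun f' hf' => ih Γ s f' hf'
  | @upd ψ ψ' χ χ' _ _ ih₁ ih₂ =>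
    intro Γ s f hf
    have e : {f' | f' ∈ Γ.Φ ∧ ∀ s' : Γ.S, Sat ψ Γ s' f'} =
        {f' | f' ∈ Γ.Φ ∧ ∀ s' : Γ.S, Sat ψ' Γ s' f'} := by
      ext f'
      exact and_congr_right fun hf' => forall_congr' fun s' => ih₁ Γ s' f' hf'
    have e' : (∀ s' : Γ.S, Sat ψ Γ s' f) ↔ ∀ s' : Γ.S, Sat ψ' Γ s' f :=
      forall_congr' fun s' => ih₁ Γ s' f hf
    simp only [Sat]
    rw [← e, ← e']
    exact forall_congr' fun hφ => ih₂ ⟨Γ.S, {f' | f' ∈ Γ.Φ ∧ ∀ s' : Γ.S, Sat ψ Γ s' f'}⟩ s f ⟨hf, hφ⟩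

theorem Provable.sat [Nonempty Atm] [Fintype Val] {φ : Form Atm Val} (h : Provable φ) :
    ∀ (Γ : MCM Atm Val) (s : Γ.S) (f : Γ.S → Val), f ∈ Γ.Φ → Sat φ Γ s f := by
  induction h with
  | taut h => exact fun Γ s f _ => (propEval_sat _ Γ s f).1 (h _)
  | mp _ _ ih₁ ih₂ => exact fun Γ s f hf => sat_imp.1 (ih₁ Γ s f hf) (ih₂ Γ s f hf)
  | kI φ ψ =>
    exact fun Γ s f _ => sat_imp.2 fun h s' => sat_imp.1 (h.2 s') (h.1 s')
  | tI φ => exact fun Γ s f _ => sat_imp.2 fun h => h s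
  | fourI φ => exact fun Γ s f _ => sat_imp.2 fun h _ => h
  | fiveI φ => exact fun Γ s f _ => sat_imp.2 fun h _ => h
  | necI _ ih => exact fun Γ s f hf s' => ih Γ s' f hf
  | kF φ ψ =>
    exact fun Γ s f _ => sat_imp.2 fun h f' hf' => sat_imp.1 (h.2 f' hf') (h.1 f' hf')
  | tF φ => exact fun Γ s f hf => sat_imp.2 fun h => h f hf
  | fourF φ => exact fun Γ s f _ => sat_imp.2 fun h _ _ => h
  | fiveF φ => exact fun Γ s f _ => sat_imp.2 fun h _ _ => h
  | necF _ ih => exact fun Γ s f _ f' hf' => ih Γ s f' hf'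
  | comm φ =>
    exact fun Γ s f _ => sat_iff.2 ⟨fun h s' f' hf' => h f' hf' s', fun h f' hf' s' => h s' f' hf'⟩
  | atLeast =>
    exact fun Γ s f _ => sat_foldr_or (x := f s) (Finset.mem_toList.2 (Finset.mem_univ _)) rfl
  | atMost hxy => exact fun Γ s f _ => sat_imp.2 fun h h' => hxy (h.symm.trans h')
  | indepPos p => exact fun Γ s f _ => sat_imp.2 fun h _ _ => h
  | indepNeg p => exact fun Γ s f _ => sat_imp.2 fun h _ _ => h
  | redAtom φ p =>
    intro Γ s f _
    rw [sat_iff, sat_imp]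
    rfl
  | redDec φ x =>
    intro Γ s f _
    rw [sat_iff, sat_imp]
    rfl
  | redNeg φ ψ =>
    intro Γ s f _
    rw [sat_iff, sat_imp]
    simp only [Sat]
    tauto
  | redAnd φ ψ₁ ψ₂ =>
    intro Γ s f _
    rw [sat_iff]
    simp only [Sat]
    tauto
  | redBoxI φ ψ =>
    intro Γ s f _
    rw [sat_iff, sat_imp]
    exact ⟨fun h hφ s' _ => h hφ s', fun h hφ s' => h hφ s' hφ⟩
  | redBoxF φ ψ =>
    intro Γ s f _
    rw [sat_iff, sat_imp]
    exact ⟨fun h hφ f' hf' hφ' => h hφ f' ⟨hf', hφ'⟩, fun h hφ f' hf' => h hφ f' hf'.1 hf'.2⟩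
  | re _ hr ih =>
    exact fun Γ s f hf => sat_iff.2 (sat_repl (fun Γ s f hf => sat_iff.1 (ih Γ s f hf)) hr Γ s f hf)

theorem valid_iff {φ : Form Atm Val} :
    Valid φ ↔ ∀ (Γ : MCM Atm Val) (s : Γ.S) (f : Γ.S → Val), f ∈ Γ.Φ → Sat φ Γ s f := by
  simp only [Valid, Satisfiable, Sat, not_exists, not_and, not_not]

end Soundness

section Reduction

variable {Atm Val : Type*}

/-- Formulas without update operators. -/
def Form.Static : Form Atm Val → Prop
  | atom _ => True
  | dec _ => True
  | neg φ => φ.Static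
  | and φ ψ => φ.Static ∧ ψ.Static
  | boxI φ => φ.Static
  | boxF φ => φ.Static
  | upd _ _ => False

/-- The reduct of `[φ] ψ`, for static `ψ`. -/
def Form.reduct (φ : Form Atm Val) : Form Atm Val → Form Atm Val
  | atom p => imp (boxI φ) (atom p)
  | dec x => imp (boxI φ) (dec x)
  | neg ψ => imp (boxI φ) (neg (reduct φ ψ))
  | and ψ χ => and (reduct φ ψ) (reduct φ χ)
  | boxI ψ => imp (boxI φ) (boxI (reduct φ ψ))
  | boxF ψ => imp (boxI φ) (boxF (reduct φ ψ))
  | upd ψ χ => upd φ (upd ψ χ)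

/-- The static translation of a formula. -/
def Form.translate : Form Atm Val → Form Atm Val
  | atom p => atom p
  | dec x => dec x
  | neg φ => neg φ.translate
  | and φ ψ => and φ.translate ψ.translate
  | boxI φ => boxI φ.translate
  | boxF φ => boxF φ.translate
  | upd φ ψ => reduct φ.translate ψ.translate

theorem static_reduct {φ ψ : Form Atm Val} (hφ : φ.Static) (hψ : ψ.Static) :
    (reduct φ ψ).Static := by
  induction ψ <;> simp_all [Form.reduct, Form.Static, imp]

theorem static_translate (φ : Form Atm Val) : φ.translate.Static := by
  induction φ with
  | upd φ ψ ih₁ ih₂ => exact static_reduct ih₁ ih₂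
  | _ => simp_all [Form.translate, Form.Static]

/-- The atoms of a static formula. -/
def Form.atoms : Form Atm Val → Set Atm
  | atom p => {p}
  | dec _ => ∅
  | neg φ => φ.atoms
  | and φ ψ => φ.atoms ∪ ψ.atoms
  | boxI φ => φ.atoms
  | boxF φ => φ.atoms
  | upd _ _ => ∅

theorem finite_atoms (φ : Form Atm Val) : φ.atoms.Finite := by
  induction φ <;> simp_all [Form.atoms]

variable [Nonempty Atm] [Fintype Val]

theorem Provable.iff_refl (φ : Form Atm Val) : Provable (iff φ φ) :=
  .taut fun v => by simp only [Form.iff, imp, propEval]; tauto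

theorem Provable.iff_trans {φ ψ χ : Form Atm Val} (h₁ : Provable (iff φ ψ))
    (h₂ : Provable (iff ψ χ)) : Provable (iff φ χ) := by
  refine .mp (.mp (.taut (φ := imp (iff φ ψ) (imp (iff ψ χ) (iff φ χ))) fun v => ?_) h₁) h₂
  simp only [Form.iff, imp, propEval]; tauto

theorem Provable.iff_mpr {φ ψ : Form Atm Val} (h : Provable (iff φ ψ)) (hψ : Provable ψ) :
    Provable φ := by
  refine .mp (.mp (.taut (φ := imp (iff φ ψ) (imp ψ φ)) fun v => ?_) h) hψ
  simp only [Form.iff, imp, propEval]; tauto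

theorem provable_reduct (φ : Form Atm Val) {ψ : Form Atm Val} (hψ : ψ.Static) :
    Provable (iff (upd φ ψ) (reduct φ ψ)) := by
  induction ψ with
  | atom p => exact .redAtom φ p
  | dec x => exact .redDec φ x
  | neg ψ ih =>
    exact (Provable.redNeg φ ψ).iff_trans
      (.re (ih hψ) (.neg (.and (.refl _) (.neg (.neg .here)))))
  | and ψ χ ih₁ ih₂ =>
    exact ((Provable.redAnd φ ψ χ).iff_trans (.re (ih₁ hψ.1) (.and .here (.refl _)))).iff_trans
      (.re (ih₂ hψ.2) (.and (.refl _) .here))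
  | boxI ψ ih =>
    exact (Provable.redBoxI φ ψ).iff_trans
      (.re (ih hψ) (.neg (.and (.refl _) (.neg (.boxI .here)))))
  | boxF ψ ih =>
    exact (Provable.redBoxF φ ψ).iff_trans
      (.re (ih hψ) (.neg (.and (.refl _) (.neg (.boxF .here)))))
  | upd => exact hψ.elim

theorem provable_translate (φ : Form Atm Val) : Provable (iff φ φ.translate) := by
  induction φ with
  | atom p => exact .iff_refl _
  | dec x => exact .iff_refl _
  | neg φ ih => exact .re ih (.neg .here)
  | boxI φ ih => exact .re ih (.boxI .here)
  | boxF φ ih => exact .re ih (.boxF .here)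
  | and φ ψ ih₁ ih₂ =>
    exact Provable.iff_trans (.re ih₁ (.and .here (.refl _))) (.re ih₂ (.and (.refl _) .here))
  | upd φ ψ ih₁ ih₂ =>
    exact (Provable.iff_trans (.re ih₁ (.upd .here (.refl _)))
      (.re ih₂ (.upd (.refl _) .here))).iff_trans (provable_reduct _ (static_translate ψ))

end Reduction

section Theories

variable {Atm Val : Type*} [Nonempty Atm] [Fintype Val]

/-- Sets of formulas that contain all theorems and are closed under modus ponens. -/
structure IsTheory (T : Set (Form Atm Val)) : Prop where
  of_provable {φ : Form Atm Val} : Provable φ → φ ∈ T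
  mp {φ ψ : Form Atm Val} : imp φ ψ ∈ T → φ ∈ T → ψ ∈ T

/-- Complete consistent theories. -/
structure IsComplete (T : Set (Form Atm Val)) : Prop extends IsTheory T where
  neg_mem {φ : Form Atm Val} : neg φ ∈ T ↔ φ ∉ T

namespace IsTheory

variable {T : Set (Form Atm Val)} {φ ψ χ : Form Atm Val}

theorem taut (hT : IsTheory T) (h : Tautology φ) : φ ∈ T := hT.of_provable (.taut h)

theorem mono (hT : IsTheory T) (h : Provable (imp φ ψ)) (hφ : φ ∈ T) : ψ ∈ T :=
  hT.mp (hT.of_provable h) hφ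

theorem and_mem (hT : IsTheory T) : and φ ψ ∈ T ↔ φ ∈ T ∧ ψ ∈ T := by
  refine ⟨fun h => ⟨hT.mono (.taut fun v => ?_) h, hT.mono (.taut fun v => ?_) h⟩,
    fun h => hT.mp (hT.mono (.taut fun v => ?_) h.1) h.2⟩ <;>
  · simp only [imp, propEval]; tauto

theorem imp_mp (hT : IsTheory T) (h₁ : imp φ (imp ψ χ) ∈ T) (h₂ : imp φ ψ ∈ T) :
    imp φ χ ∈ T := by
  refine hT.mp (hT.mp (hT.taut (φ := imp (imp φ (imp ψ χ)) (imp (imp φ ψ) (imp φ χ)))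
    fun v => ?_) h₁) h₂
  simp only [imp, propEval]; tauto

theorem imp_intro (hT : IsTheory T) (h : ψ ∈ T) : imp φ ψ ∈ T := by
  refine hT.mono (.taut fun v => ?_) h
  simp only [imp, propEval]; tauto

theorem imp_self (hT : IsTheory T) : imp φ φ ∈ T :=
  hT.taut fun v => by simp only [imp, propEval]; tauto

theorem imp_trans (hT : IsTheory T) (h₁ : imp φ ψ ∈ T) (h₂ : imp ψ χ ∈ T) : imp φ χ ∈ T :=
  hT.imp_mp (hT.imp_intro h₂) h₁

/-- The theory generated by a theory and one further formula. -/
theorem adjoin (hT : IsTheory T) (φ : Form Atm Val) : IsTheory {ψ | imp φ ψ ∈ T} where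
  of_provable h := hT.imp_intro (hT.of_provable h)
  mp h₁ h₂ := hT.imp_mp h₁ h₂

/-- Lindenbaum's lemma. -/
theorem exists_isComplete (hT : IsTheory T) (hφ : φ ∉ T) :
    ∃ w, IsComplete w ∧ T ⊆ w ∧ φ ∉ w := by
  obtain ⟨M, hTM, hM⟩ := zorn_subset_nonempty {U : Set (Form Atm Val) | IsTheory U ∧ φ ∉ U}
    (by
      intro c hc hchain ⟨U₀, hU₀⟩
      refine ⟨⋃₀ c, ⟨⟨fun h => ⟨U₀, hU₀, (hc hU₀).1.of_provable h⟩, ?_⟩, ?_⟩,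
        fun U hU => Set.subset_sUnion_of_mem hU⟩
      · rintro ψ χ ⟨U, hU, h₁⟩ ⟨V, hV, h₂⟩
        rcases hchain.total hU hV with h | h
        · exact ⟨V, hV, (hc hV).1.mp (h h₁) h₂⟩
        · exact ⟨U, hU, (hc hU).1.mp h₁ (h h₂)⟩
      · rintro ⟨U, hU, h⟩
        exact (hc hU).2 h) T ⟨hT, hφ⟩
  have hth : IsTheory M := hM.prop.1
  have key : ∀ ψ, ψ ∉ M → imp ψ φ ∈ M := fun ψ hψ => by
    by_contra h
    exact hψ (hM.le_of_ge ⟨hth.adjoin ψ, h⟩ (fun χ hχ => hth.imp_intro hχ)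
      (show imp ψ ψ ∈ M from hth.imp_self))
  refine ⟨M, ⟨hth, fun {ψ} => ⟨fun h₁ h₂ => hM.prop.2 ?_, fun h => ?_⟩⟩, hTM, hM.prop.2⟩
  · refine hth.mp (hth.mono (.taut fun v => ?_) h₁) h₂
    simp only [imp, propEval]; tauto
  · by_contra h'
    refine hM.prop.2 (hth.mp (hth.mono (.taut fun v => ?_) (key _ h)) (key _ h'))
    simp only [imp, propEval]; tauto

end IsTheory

theorem isTheory_provable : IsTheory {φ : Form Atm Val | Provable φ} := ⟨id, .mp⟩

/-- Operators that satisfy the axioms and the rule of S5. -/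
structure IsS5 (b : Form Atm Val → Form Atm Val) : Prop where
  k (φ ψ : Form Atm Val) : Provable (imp (and (b φ) (b (imp φ ψ))) (b ψ))
  t (φ : Form Atm Val) : Provable (imp (b φ) φ)
  four (φ : Form Atm Val) : Provable (imp (b φ) (b (b φ)))
  five (φ : Form Atm Val) : Provable (imp (neg (b φ)) (b (neg (b φ))))
  nec {φ : Form Atm Val} : Provable φ → Provable (b φ)

theorem isS5_boxI : IsS5 (boxI : Form Atm Val → Form Atm Val) := ⟨.kI, .tI, .fourI, .fiveI, .necI⟩

theorem isS5_boxF : IsS5 (boxF : Form Atm Val → Form Atm Val) := ⟨.kF, .tF, .fourF, .fiveF, .necF⟩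

/-- The accessibility relation of the canonical model for the operator `b`. -/
def Acc (b : Form Atm Val → Form Atm Val) (w u : Set (Form Atm Val)) : Prop :=
  ∀ φ, b φ ∈ w → φ ∈ u

namespace IsS5

variable {b : Form Atm Val → Form Atm Val} {w u v : Set (Form Atm Val)}

theorem isTheory (hb : IsS5 b) (hw : IsTheory w) : IsTheory {φ | b φ ∈ w} where
  of_provable h := hw.of_provable (hb.nec h)
  mp h₁ h₂ := hw.mono (hb.k _ _) (hw.and_mem.2 ⟨h₂, h₁⟩)

theorem mono (hb : IsS5 b) (hw : IsTheory w) {φ ψ : Form Atm Val} (h : Provable (imp φ ψ))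
    (hφ : b φ ∈ w) : b ψ ∈ w :=
  (hb.isTheory hw).mono h hφ

theorem acc_refl (hb : IsS5 b) (hw : IsTheory w) : Acc b w w := fun φ h => hw.mono (hb.t φ) h

theorem acc_trans (hb : IsS5 b) (hw : IsTheory w) (h₁ : Acc b w u) (h₂ : Acc b u v) :
    Acc b w v := fun φ h => h₂ φ (h₁ _ (hw.mono (hb.four φ) h))

theorem acc_symm (hb : IsS5 b) (hw : IsComplete w) (hu : IsComplete u) (h : Acc b w u) :
    Acc b u w := fun φ hφ => by
  by_contra hn
  have : b φ ∉ w := fun h' => hn (hw.mono (hb.t φ) h')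
  exact hu.neg_mem.1 (h _ (hw.mono (hb.five φ) (hw.neg_mem.2 this))) hφ

theorem mem_iff (hb : IsS5 b) (hw : IsComplete w) {φ : Form Atm Val} :
    b φ ∈ w ↔ ∀ u, IsComplete u → Acc b w u → φ ∈ u := by
  refine ⟨fun h u _ hu => hu φ h, fun h => ?_⟩
  by_contra hn
  obtain ⟨u, hu, hwu, hφ⟩ := (hb.isTheory hw.toIsTheory).exists_isComplete (φ := φ) hn
  exact hφ (h u hu fun ψ hψ => hwu hψ)

end IsS5

/-- The two canonical accessibility relations commute. -/
theorem exists_acc_comm {w u v : Set (Form Atm Val)} (hw : IsComplete w)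
    (hv : IsComplete v) (hwu : Acc boxF w u) (huv : Acc boxI u v) :
    ∃ m, IsComplete m ∧ Acc boxI w m ∧ Acc boxF m v := by
  have hI := isS5_boxI.isTheory hw.toIsTheory
  have hF := isS5_boxF.isTheory hv.toIsTheory
  have hT : IsTheory {ψ | ∃ β, boxF β ∈ v ∧ boxI (imp (boxF β) ψ) ∈ w} := by
    constructor
    · intro ψ hψ
      exact ⟨ψ, hF.of_provable hψ, hI.imp_intro (hI.of_provable hψ)⟩
    · rintro ψ χ ⟨β, hβ, h₁⟩ ⟨γ, hγ, h₂⟩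
      refine ⟨and β γ, hF.and_mem.2 ⟨hβ, hγ⟩, ?_⟩
      have mono : ∀ {α δ : Form Atm Val}, Tautology (imp α δ) →
          Provable (imp (boxF α) (boxF δ)) := fun {α δ} h => by
        refine .mp (.mp (.taut (φ := imp (imp (and (boxF α) (boxF (imp α δ))) (boxF δ))
          (imp (boxF (imp α δ)) (imp (boxF α) (boxF δ)))) fun v => ?_)
          (.kF α δ)) (.necF (.taut h))
        simp only [imp, propEval]; tauto
      refine hI.imp_mp (hI.imp_trans (hI.of_provable (mono fun v => ?_)) h₁)
        (hI.imp_trans (hI.of_provable (mono fun v => ?_)) h₂) <;>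
      · simp only [imp, propEval]; tauto
  obtain ⟨m, hm, hTm, -⟩ := hT.exists_isComplete (φ := bot) (by
    rintro ⟨β, hβ, h⟩
    have h₁ : boxI (neg (boxF β)) ∈ w := by
      refine isS5_boxI.mono hw.toIsTheory (.taut fun v => ?_) h
      simp only [imp, propEval, bot]; tauto
    have h₂ : boxI (boxF (neg (boxF β))) ∈ w := isS5_boxI.mono hw.toIsTheory (.fiveF β) h₁
    have h₃ : boxF (boxI (neg (boxF β))) ∈ w := hw.mp (hw.and_mem.1 (hw.of_provable (.comm _))).2 h₂
    exact hv.neg_mem.1 (huv _ (hwu _ h₃)) hβ)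
  refine ⟨m, hm, fun ψ hψ => hTm ⟨imp ψ ψ, hF.imp_self, hI.imp_intro hψ⟩,
    isS5_boxF.acc_symm hv hm fun β hβ => hTm ⟨β, hβ, hI.of_provable (.tF β)⟩⟩

theorem exists_dec_mem {w : Set (Form Atm Val)} (hw : IsComplete w) : ∃ x, dec x ∈ w := by
  by_contra! h
  have : ∀ l : List Val, ((l.map dec).foldr Form.or bot : Form Atm Val) ∉ w := by
    intro l
    induction l with
    | nil =>
      intro hb
      obtain ⟨h₁, h₂⟩ := hw.and_mem.1 hb
      exact hw.neg_mem.1 h₂ h₁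
    | cons a l ih =>
      exact fun hb => hw.neg_mem.1 hb (hw.and_mem.2 ⟨hw.neg_mem.2 (h a), hw.neg_mem.2 ih⟩)
  exact this _ (hw.of_provable .atLeast)

theorem dec_mem_unique {w : Set (Form Atm Val)} (hw : IsComplete w) {x y : Val}
    (hx : dec x ∈ w) (hy : dec y ∈ w) : x = y := by
  by_contra h
  exact hw.neg_mem.1 (hw.mono (.atMost h) hx) hy

theorem atom_mem_iff {w u : Set (Form Atm Val)} (hw : IsComplete w) (hu : IsComplete u)
    (h : Acc boxF w u) (p : Atm) : atom p ∈ w ↔ atom p ∈ u := by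
  refine ⟨fun hp => h _ (hw.mono (.indepPos p) hp), fun hp => ?_⟩
  by_contra hn
  exact hu.neg_mem.1 (h _ (hw.mono (.indepNeg p) (hw.neg_mem.2 hn))) hp

end Theories

section Canonical

variable {Atm Val : Type*} [Nonempty Atm] [Fintype Val]

/-- The complete theories in the connected component of `r` in the canonical model. -/
def Component (r : Set (Form Atm Val)) : Set (Set (Form Atm Val)) :=
  {w | IsComplete w ∧ ∃ m, IsComplete m ∧ Acc boxF r m ∧ Acc boxI m w}

variable {r a b w u : Set (Form Atm Val)}

theorem mem_component_self (hr : IsComplete r) : r ∈ Component r :=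
  ⟨hr, r, hr, isS5_boxF.acc_refl hr.toIsTheory, isS5_boxI.acc_refl hr.toIsTheory⟩

theorem exists_acc_comm' {w u v : Set (Form Atm Val)} (hw : IsComplete w) (hu : IsComplete u)
    (hv : IsComplete v) (hwu : Acc boxI w u) (huv : Acc boxF u v) :
    ∃ m, IsComplete m ∧ Acc boxF w m ∧ Acc boxI m v := by
  obtain ⟨m, hm, h₁, h₂⟩ := exists_acc_comm hv hw (isS5_boxF.acc_symm hu hv huv)
    (isS5_boxI.acc_symm hw hu hwu)
  exact ⟨m, hm, isS5_boxF.acc_symm hm hw h₂, isS5_boxI.acc_symm hv hm h₁⟩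

theorem Component.boxI (hw : w ∈ Component r) (hu : IsComplete u) (h : Acc boxI w u) :
    u ∈ Component r := by
  obtain ⟨-, m, hm, h₁, h₂⟩ := hw
  exact ⟨hu, m, hm, h₁, isS5_boxI.acc_trans hm.toIsTheory h₂ h⟩

theorem Component.boxF (hr : IsComplete r) (hw : w ∈ Component r) (hu : IsComplete u)
    (h : Acc boxF w u) : u ∈ Component r := by
  obtain ⟨hw, m, hm, h₁, h₂⟩ := hw
  obtain ⟨n, hn, h₃, h₄⟩ := exists_acc_comm' hm hw hu h₂ h
  exact ⟨hu, n, hn, isS5_boxF.acc_trans hr.toIsTheory h₁ h₃, h₄⟩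

/-- The complete theories in the `□_F`-class of `a` and the `□_I`-class of `b`. -/
def Cell (a b : Set (Form Atm Val)) : Set (Set (Form Atm Val)) :=
  {w | IsComplete w ∧ Acc boxF a w ∧ Acc boxI b w}

theorem cell_nonempty (hr : IsComplete r) (ha : a ∈ Component r) (hb : b ∈ Component r) :
    (Cell a b).Nonempty := by
  obtain ⟨ha, m, hm, h₁, h₂⟩ := ha
  obtain ⟨hb, n, hn, h₃, h₄⟩ := hb
  obtain ⟨k, hk, h₅, h₆⟩ := exists_acc_comm' ha hm hn (isS5_boxI.acc_symm hm ha h₂)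
    (isS5_boxF.acc_trans hm.toIsTheory (isS5_boxF.acc_symm hr hm h₁) h₃)
  exact ⟨k, hk, h₅, isS5_boxI.acc_symm hk hb (isS5_boxI.acc_trans hk.toIsTheory h₆ h₄)⟩

variable (r) in
/-- Row and column indices of the grid that covers the component of `r`: an element of the
component together with a shift. -/
abbrev Index : Type _ := Component r × Set (Form Atm Val)

open Classical in
/-- The covering map from the grid to the component: sums of shifts hit every element of a cell
from every row and from every column. -/
noncomputable def cover (hr : IsComplete r) (x y : Index r) : Set (Form Atm Val) :=
  if symmDiff x.2 y.2 ∈ Cell x.1.1 y.1.1 then symmDiff x.2 y.2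
  else (cell_nonempty hr x.1.2 y.1.2).some

theorem cover_mem (hr : IsComplete r) (x y : Index r) : cover hr x y ∈ Cell x.1.1 y.1.1 := by
  unfold cover
  split_ifs with h
  · exact h
  · exact (cell_nonempty hr x.1.2 y.1.2).some_mem

theorem cover_eq (hr : IsComplete r) {x y : Index r} (h : symmDiff x.2 y.2 = w)
    (hw : w ∈ Cell x.1.1 y.1.1) : cover hr x y = w := by
  subst h
  exact if_pos hw

theorem boxI_mem_cover (hr : IsComplete r) (x y : Index r) (φ : Form Atm Val) :
    boxI φ ∈ cover hr x y ↔ ∀ x', φ ∈ cover hr x' y := by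
  obtain ⟨hc, -, hy⟩ := cover_mem hr x y
  have hyc := y.1.2.1
  refine ⟨fun h x' => ?_, fun h => (isS5_boxI.mem_iff hc).2 fun u hu hcu => ?_⟩
  · exact isS5_boxI.acc_trans hc.toIsTheory (isS5_boxI.acc_symm hyc hc hy)
      (cover_mem hr x' y).2.2 φ h
  · have hyu := isS5_boxI.acc_trans hyc.toIsTheory hy hcu
    have := h (⟨u, Component.boxI y.1.2 hu hyu⟩, symmDiff u y.2)
    rwa [cover_eq hr (symmDiff_symmDiff_cancel_right _ _)
      ⟨hu, isS5_boxF.acc_refl hu.toIsTheory, hyu⟩] at this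

theorem boxF_mem_cover (hr : IsComplete r) (x y : Index r) (φ : Form Atm Val) :
    boxF φ ∈ cover hr x y ↔ ∀ y', φ ∈ cover hr x y' := by
  obtain ⟨hc, hx, -⟩ := cover_mem hr x y
  have hxc := x.1.2.1
  refine ⟨fun h y' => ?_, fun h => (isS5_boxF.mem_iff hc).2 fun u hu hcu => ?_⟩
  · exact isS5_boxF.acc_trans hc.toIsTheory (isS5_boxF.acc_symm hxc hc hx)
      (cover_mem hr x y').2.1 φ h
  · have hxu := isS5_boxF.acc_trans hxc.toIsTheory hx hcu
    have := h (⟨u, Component.boxF hr x.1.2 hu hxu⟩, symmDiff x.2 u)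
    rwa [cover_eq hr (symmDiff_symmDiff_cancel_left _ _)
      ⟨hu, hxu, isS5_boxI.acc_refl hu.toIsTheory⟩] at this

/-- The output value at a point of the grid. -/
noncomputable def output (hr : IsComplete r) (x y : Index r) : Val :=
  (exists_dec_mem (cover_mem hr x y).1).choose

theorem output_eq_iff (hr : IsComplete r) (x y : Index r) (c : Val) :
    output hr x y = c ↔ dec c ∈ cover hr x y := by
  have h := (exists_dec_mem (cover_mem hr x y).1).choose_spec
  refine ⟨fun e => e ▸ h, fun hc => dec_mem_unique (cover_mem hr x y).1 h hc⟩

/-- The multi-classifier model over the grid, where `v` turns row indices into inputs. -/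
noncomputable def gridModel (hr : IsComplete r) {v : Index r → Set Atm}
    (hv : Function.Injective v) : MCM Atm Val where
  S := Set.range v
  Φ := Set.range fun y s => output hr ((Equiv.ofInjective v hv).symm s) y

theorem sat_gridModel (hr : IsComplete r) {v : Index r → Set Atm} (hv : Function.Injective v)
    {φ : Form Atm Val} (hφ : φ.Static)
    (hat : ∀ p ∈ φ.atoms, ∀ x : Index r, p ∈ v x ↔ atom p ∈ x.1.1) (x y : Index r) :
    Sat φ (gridModel hr hv) (Equiv.ofInjective v hv x)
      (fun s => output hr ((Equiv.ofInjective v hv).symm s) y) ↔ φ ∈ cover hr x y := by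
  induction φ generalizing x y with
  | atom p =>
    obtain ⟨hc, hx, -⟩ := cover_mem hr x y
    exact (hat p rfl x).trans (atom_mem_iff x.1.2.1 hc hx p)
  | dec c =>
    rw [← output_eq_iff]
    simp only [Sat]
    rw [Equiv.symm_apply_apply]
  | neg φ ih =>
    rw [(cover_mem hr x y).1.neg_mem, ← ih hφ hat]
    rfl
  | and φ ψ ih₁ ih₂ =>
    rw [(cover_mem hr x y).1.and_mem, ← ih₁ hφ.1 fun p hp => hat p (.inl hp),
      ← ih₂ hφ.2 fun p hp => hat p (.inr hp)]
    rfl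
  | boxI φ ih =>
    rw [boxI_mem_cover]
    simp only [← ih hφ hat]
    exact (Equiv.ofInjective v hv).forall_congr_right.symm
  | boxF φ ih =>
    rw [boxF_mem_cover]
    simp only [← ih hφ hat]
    exact Set.forall_mem_range
  | upd => exact hφ.elim

end Canonical

section Completeness

/-- A numbering of formulas. -/
def Form.code {Atm Val : Type*} (i : Atm → ℕ) (j : Val → ℕ) : Form Atm Val → ℕ
  | atom p => Nat.pair 0 (i p)
  | dec x => Nat.pair 1 (j x)
  | neg φ => Nat.pair 2 (φ.code i j)
  | and φ ψ => Nat.pair 3 (Nat.pair (φ.code i j) (ψ.code i j))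
  | boxI φ => Nat.pair 4 (φ.code i j)
  | boxF φ => Nat.pair 5 (φ.code i j)
  | upd φ ψ => Nat.pair 6 (Nat.pair (φ.code i j) (ψ.code i j))

instance {Atm Val : Type*} [Countable Atm] [Countable Val] : Countable (Form Atm Val) := by
  obtain ⟨i, hi⟩ := exists_injective_nat Atm
  obtain ⟨j, hj⟩ := exists_injective_nat Val
  refine ⟨⟨Form.code i j, fun φ => ?_⟩⟩
  induction φ with
  | atom p => intro ψ h; cases ψ <;> simp_all [code, hi.eq_iff]
  | dec x => intro ψ h; cases ψ <;> simp_all [code, hj.eq_iff]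
  | neg φ ih => intro ψ h; cases ψ <;> simp [code] at h ⊢; exact ih h
  | boxI φ ih => intro ψ h; cases ψ <;> simp [code] at h ⊢; exact ih h
  | boxF φ ih => intro ψ h; cases ψ <;> simp [code] at h ⊢; exact ih h
  | and φ χ ih₁ ih₂ => intro ψ h; cases ψ <;> simp [code] at h ⊢; exact ⟨ih₁ h.1, ih₂ h.2⟩
  | upd φ χ ih₁ ih₂ => intro ψ h; cases ψ <;> simp [code] at h ⊢; exact ⟨ih₁ h.1, ih₂ h.2⟩

variable {Atm Val : Type*} [Countable Atm] [Infinite Atm] [Fintype Val]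

/-- Inputs can be told apart by the atoms outside a finite set `A`, with the atoms in `A` as
prescribed. -/
theorem exists_injective_inputs (r : Set (Form Atm Val)) {A : Set Atm} (hA : A.Finite) :
    ∃ v : Index r → Set Atm, Function.Injective v ∧
      ∀ p ∈ A, ∀ x : Index r, p ∈ v x ↔ atom p ∈ x.1.1 := by
  have : Infinite ↥Aᶜ := hA.infinite_compl.to_subtype
  obtain ⟨i, hi⟩ := exists_injective_nat (Form Atm Val ⊕ Form Atm Val)
  let k : Form Atm Val ⊕ Form Atm Val → Atm := fun n => Infinite.natEmbedding ↥Aᶜ (i n)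
  have hk : Function.Injective k :=
    Subtype.val_injective.comp ((Infinite.natEmbedding ↥Aᶜ).injective.comp hi)
  have hkA : ∀ n, k n ∉ A := fun n => (Infinite.natEmbedding ↥Aᶜ (i n)).2
  let v : Index r → Set Atm := fun x =>
    {p | p ∈ A ∧ atom p ∈ x.1.1} ∪ k '' (Sum.inl '' x.1.1 ∪ Sum.inr '' x.2)
  have hv : ∀ x n, k n ∈ v x ↔ n ∈ Sum.inl '' x.1.1 ∪ Sum.inr '' x.2 := fun x n => by
    simp only [v, Set.mem_union, Set.mem_ofPred_eq, hkA, false_and, false_or, hk.mem_set_image]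
  refine ⟨v, fun x y h => ?_, fun p hp x => ?_⟩
  · refine Prod.ext (Subtype.ext (Set.ext fun φ => ?_)) (Set.ext fun φ => ?_)
    · simpa [hv] using (h ▸ Iff.rfl : k (.inl φ) ∈ v x ↔ k (.inl φ) ∈ v y)
    · simpa [hv] using (h ▸ Iff.rfl : k (.inr φ) ∈ v x ↔ k (.inr φ) ∈ v y)
  · refine ⟨?_, fun h => .inl ⟨hp, h⟩⟩
    rintro (h | ⟨n, -, rfl⟩)
    · exact h.2
    · exact (hkA n hp).elim

theorem Form.Static.provable {φ : Form Atm Val} (hφ : φ.Static) (h : Valid φ) : Provable φ := by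
  by_contra hn
  obtain ⟨r, hr, -, hφr⟩ := isTheory_provable.exists_isComplete (φ := φ) hn
  obtain ⟨v, hv, hat⟩ := exists_injective_inputs r (finite_atoms φ)
  let c : Component r := ⟨r, mem_component_self hr⟩
  have hs := (sat_gridModel hr hv hφ hat (c, r) (c, ∅)).1
    (valid_iff.1 h _ _ _ (Set.mem_range_self _))
  rw [cover_eq hr (symmDiff_bot r) ⟨hr, isS5_boxF.acc_refl hr.toIsTheory,
    isS5_boxI.acc_refl hr.toIsTheory⟩] at hs
  exact hφr hs

end Completeness

end DWPLC

theorem mainTheorem11 {Atm : Type*} {Val : Type*} [Countable Atm] [Infinite Atm] [Fintype Val]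
    (φ : DWPLC.Form Atm Val) :
    DWPLC.Provable φ ↔ DWPLC.Valid φ := by
  open DWPLC in
  refine ⟨fun h => valid_iff.2 h.sat, fun h => ?_⟩
  have hφ := provable_translate φ
  refine hφ.iff_mpr ((static_translate φ).provable (valid_iff.2 fun Γ s f hf => ?_))
  exact (sat_iff.1 (hφ.sat Γ s f hf)).1 (valid_iff.1 h Γ s f hf)
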